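/- **Setting.** Let $D\ge 1$, $L\ge1$ and $\Lambda=\mathbb Z_L^D$ (periodic cubic lattice) with the $\ell_\infty$-distance. Every site carries finitely many qubits. A *local stabilizer code* on $\Lambda$ is given by finitely many commuting Pauli operators (generators), each located at an elementary cube of $\Lambda$ and acting only on qubits at the vertices of that cube; several generators may be located at the same cube. Pauli operators are taken modulo phases. Products of generators are called stabilizers. The *syndrome* $S(P)$ of a Pauli operator $P$ is the set of generators (defects) anticommuting with $P$. A cluster is a set of defects; distances between defects are distances between the centres of their cubes. Let $L_{tqo}$ be an integer with $L_{tqo}\le L/2$. A cluster $S$ is *neutral* if $S=S(P)$ for some $P$ whose support is enclosed by a cube of linear size $L_{tqo}$. The *minimal enclosing region* of a cluster means a smallest rectangular box (first convention) or a smallest cube (second convention), with corners at centres of elementary cubes, that contains the centres of all cubes occupied by the cluster. Either convention may be used, but the same one in TQO2 and in the decoder. If the minimal enclosing region is not unique, "in the minimal enclosing region" means "in one of them". * **TQO1:** every $P$ with empty syndrome whose support is enclosed by a cube of linear size $L_{tqo}$ is a stabilizer. * **TQO2:** every neutral cluster is the syndrome of a Pauli operator supported on the $1$-neighbourhood of its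 minimal enclosing region. **RG decoder.** On a nonempty cluster $M$, *TestNeutral* returns some Pauli operator $P$ with $S(P)=M$ supported on the $1$-neighbourhood of the minimal enclosing region of $M$, provided that this region has linear size at most $L_{tqo}$ and such a $P$ exists; otherwise it returns the identity. A set of defects is $r$-connected if it cannot be divided into two nonempty parts at distance $>r$. *EC*$(p)$ applied to $S$ returns the product of TestNeutral$(M)$ over the $2^p$-connected components $M$ of $S$. The RG decoder starts from a syndrome $S$ and $P_{ec}=I$, and successively for all $p=0,1,\dots$ with $2^p<L_{tqo}$ computes $R=\mathrm{EC}(p)(S)$ and replaces $P_{ec}$ by $P_{ec}R$ and $S$ by the symmetric difference $S\oplus S(R)$. It returns $P_{ec}$ if finally $S=\emptyset$ and declares failure otherwise. It *corrects* $P$ if on input $S(P)$ it returns an operator $P_{ec}$ such that $P P_{ec}$ is a stabilizer; otherwise it *fails* on $P$. **Noise.** A random Pauli error $P$ has site error rate $\epsilon$ if the set $E(P)$ of sites on which $P$ acts nontrivially satisfies $\Pr[E(P)=E]=(1-\epsilon)^{L^D-|E|}\epsilon^{|E|}$ for every $E\subseteq\Lambda$. **Theorem.** Let $D\ge1$, $\gamma>0$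 and $\epsilon_0=(3Q)^{-2D}$ with $Q=10$. There is $\eta>0$, depending only on $D$ and $\gamma$, such that for every $0\le\epsilon<\epsilon_0$ there are $c>0$ and $L_0$, depending only on $D,\gamma,\epsilon$, with the following property. For every local stabilizer code on $\mathbb Z_L^D$ with $L\ge L_0$ that satisfies TQO1 and TQO2 for some $L_{tqo}$ with $L^\gamma\le L_{tqo}\le L/2$, for every implementation of TestNeutral, and for every random Pauli error with site error rate $\epsilon$, the RG decoder fails with probability at most $\exp(-c\,L^\eta)$. -/

import Mathlib

namespace TopCode

/-- The sites of the periodic cubic lattice `Z_L^D`.  The elementary cube with vertices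
`c + {0,1}^D` is labelled by its corner `c`, so that elementary cubes are labelled by the same
type; differences of labels are the differences of the centres. -/
abbrev Site (D L : ℕ) : Type := Fin D → ZMod L

section Geometry

variable {D L : ℕ}

/-- The distance of two residues on the cycle `Z_L`. -/
def cycDist (a b : ZMod L) : ℕ := min (a - b).val (b - a).val

/-- The `ℓ_∞` distance on the torus, between two sites or between (the centres of) two cubes. -/
def torusDist (u v : Site D L) : ℕ := Finset.univ.sup fun i => cycDist (u i) (v i)

/-- The vertices of the elementary cube `c`. -/
def vertices (c : Site D L) : Set (Site D L) := {u | ∀ i, u i = c i ∨ u i = c i + 1}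

/-- The (site) cube of linear size `r` at the corner `a`; it has `r + 1` sites along each axis,
hence `ℓ_∞` diameter `r` as long as it does not wrap around the torus. -/
def siteCube (a : Site D L) (r : ℕ) : Set (Site D L) := {u | ∀ i, (u i - a i).val ≤ r}

/-- A rectangular box all of whose corners are dual sites, that is, centres of elementary cubes:
it starts at the centre of the cube `corner` and has length `side i` along the axis `i`. -/
structure Box (D L : ℕ) where
  corner : Site D L
  side : Fin D → ℕ

namespace Box

/-- The elementary cubes whose centre lies in the box. -/
def cubes (B : Box D L) : Set (Site D L) := {c | ∀ i, (c i - B.corner i).val ≤ B.side i}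

/-- The linear size of the box, its longest side. -/
def size (B : Box D L) : ℕ := Finset.univ.sup B.side

/-- The sites in the `1`-neighbourhood of the box.  Sites differ from centres of cubes by
half-integers, so a site has `ℓ_∞` distance at most `1` from the box if and only if it is a
vertex of a cube whose centre lies in the box. -/
def nbhd (B : Box D L) : Set (Site D L) := {u | ∃ c ∈ B.cubes, u ∈ vertices c}

end Box

/-- The two conventions for the region that encloses a cluster of defects. -/
inductive Enclosure where
  /-- enclose by a smallest rectangular box -/
  | box
  /-- enclose by a smallest cube -/
  | cube

/-- `B` is allowed as an enclosing region. -/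
def Enclosure.Allows : Enclosure → Box D L → Prop
  | .box, _ => True
  | .cube, B => ∀ i j, B.side i = B.side j

/-- `B` is a smallest allowed region that encloses the set `A` of elementary cubes.  (The sides
of a rectangular box can be minimized independently of each other.) -/
def Enclosure.IsMin (k : Enclosure) (B : Box D L) (A : Set (Site D L)) : Prop :=
  k.Allows B ∧ A ⊆ B.cubes ∧
    ∀ B' : Box D L, k.Allows B' → A ⊆ B'.cubes → ∀ i, B.side i ≤ B'.side i

end Geometry

/-- Pauli operators modulo phases on a set of qubits: the pair at a qubit `x` consists of the
exponents of `X` and of `Z`.  Multiplication of operators is addition. -/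
abbrev Pauli (Qubit : Type) : Type := Qubit → ZMod 2 × ZMod 2

/-- The symplectic form; it is `0` when two Pauli operators commute and `1` when they
anticommute. -/
def Pauli.symp {Qubit : Type} [Fintype Qubit] (P R : Pauli Qubit) : ZMod 2 :=
  ∑ x, ((P x).1 * (R x).2 + (P x).2 * (R x).1)

/-- A local stabilizer code on the lattice `Z_L^D`: every qubit lives at a site, every stabilizer
generator is located at an elementary cube and acts only on qubits at the vertices of that cube,
and the generators commute. -/
structure Code (D L : ℕ) (Qubit Gen : Type) [Fintype Qubit] where
  site : Qubit → Site D L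
  cube : Gen → Site D L
  op : Gen → Pauli Qubit
  op_local : ∀ g x, op g x ≠ 0 → site x ∈ vertices (cube g)
  op_comm : ∀ g h, Pauli.symp (op g) (op h) = 0

namespace Code

variable {D L : ℕ} {Qubit Gen : Type} [Fintype Qubit] [Fintype Gen]

/-- The group of stabilizers. -/
def stabilizers (C : Code D L Qubit Gen) : AddSubgroup (Pauli Qubit) :=
  AddSubgroup.closure (Set.range C.op)

/-- The set of sites at which a Pauli operator acts nontrivially. -/
def supp (C : Code D L Qubit Gen) (P : Pauli Qubit) : Set (Site D L) :=
  {u | ∃ x, C.site x = u ∧ P x ≠ 0}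

open Classical in
/-- The syndrome of a Pauli operator: the set of defects, that is, of generators anticommuting
with it. -/
noncomputable def syndrome (C : Code D L Qubit Gen) (P : Pauli Qubit) : Finset Gen :=
  {g | Pauli.symp (C.op g) P ≠ 0}

/-- The first topological order condition at the length scale `ℓ`. -/
def TQO1 (C : Code D L Qubit Gen) (ℓ : ℕ) : Prop :=
  ∀ P : Pauli Qubit, C.syndrome P = ∅ → (∃ a, C.supp P ⊆ siteCube a ℓ) → P ∈ C.stabilizers

/-- A cluster of defects is neutral if it is the syndrome of a Pauli operator supported on a cube
of linear size `ℓ`. -/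
def Neutral (C : Code D L Qubit Gen) (ℓ : ℕ) (S : Finset Gen) : Prop :=
  ∃ P : Pauli Qubit, (∃ a, C.supp P ⊆ siteCube a ℓ) ∧ C.syndrome P = S

/-- `B` is a minimal enclosing region of the cluster `S`. -/
def MinEnclosing (C : Code D L Qubit Gen) (k : Enclosure) (B : Box D L) (S : Finset Gen) : Prop :=
  k.IsMin B (C.cube '' (S : Set Gen))

/-- The second topological order condition at the length scale `ℓ`: a neutral cluster is created
by a Pauli operator supported on the `1`-neighbourhood of its minimal enclosing region. -/
def TQO2 (C : Code D L Qubit Gen) (k : Enclosure) (ℓ : ℕ) : Prop :=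
  ∀ S : Finset Gen, C.Neutral ℓ S →
    ∃ B, C.MinEnclosing k B S ∧ ∃ P : Pauli Qubit, C.supp P ⊆ B.nbhd ∧ C.syndrome P = S

/-- The Pauli operators that `TestNeutral` looks for on input `S`. -/
def localAnnihilators (C : Code D L Qubit Gen) (k : Enclosure) (ℓ : ℕ) (S : Finset Gen) :
    Set (Pauli Qubit) :=
  {P | ∃ B, C.MinEnclosing k B S ∧ B.size ≤ ℓ ∧ C.supp P ⊆ B.nbhd ∧ C.syndrome P = S}

/-- `T` is an implementation of `TestNeutral`: on a nonempty cluster it returns one of the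
operators looked for, an arbitrary one, or the identity if there is none. -/
def IsTestNeutral (C : Code D L Qubit Gen) (k : Enclosure) (ℓ : ℕ)
    (T : Finset Gen → Pauli Qubit) : Prop :=
  ∀ S : Finset Gen, S.Nonempty →
    ((C.localAnnihilators k ℓ S).Nonempty → T S ∈ C.localAnnihilators k ℓ S) ∧
    (¬ (C.localAnnihilators k ℓ S).Nonempty → T S = 0)

/-- A cluster is `r`-connected if it cannot be divided into two proper subsets at a distance
larger than `r` from each other. -/
def IsConn (C : Code D L Qubit Gen) (r : ℕ) (M : Finset Gen) : Prop :=
  ∀ A A' : Set Gen, A.Nonempty → A'.Nonempty → Disjoint A A' → A ∪ A' = M →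
    ∃ g ∈ A, ∃ h ∈ A', torusDist (C.cube g) (C.cube h) ≤ r

open Classical in
/-- The `r`-connected components of `S`: its maximal nonempty `r`-connected subsets. -/
noncomputable def components (C : Code D L Qubit Gen) (r : ℕ) (S : Finset Gen) :
    Finset (Finset Gen) :=
  S.powerset.filter fun M => M.Nonempty ∧ C.IsConn r M ∧
    ∀ M', M' ⊆ S → M ⊆ M' → C.IsConn r M' → M' = M

/-- The level-`p` error correction `EC(p)`. -/
noncomputable def ec (C : Code D L Qubit Gen) (T : Finset Gen → Pauli Qubit) (p : ℕ)
    (S : Finset Gen) : Pauli Qubit :=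
  ∑ M ∈ C.components (2 ^ p) S, T M

open Classical in
/-- The accumulated correcting operator and the current syndrome after the levels `p < n`,
starting from the syndrome `S`. -/
noncomputable def rgState (C : Code D L Qubit Gen) (T : Finset Gen → Pauli Qubit)
    (S : Finset Gen) : ℕ → Pauli Qubit × Finset Gen
  | 0 => (0, S)
  | n + 1 =>
    let st := C.rgState T S n
    let R := C.ec T n st.2
    (st.1 + R, symmDiff st.2 (C.syndrome R))

/-- The number of levels of the decoder: the levels are the `p` with `2 ^ p < ℓ`. -/
def numLevels (ℓ : ℕ) : ℕ := Nat.clog 2 ℓ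

theorem lt_numLevels_iff (p ℓ : ℕ) : p < numLevels ℓ ↔ 2 ^ p < ℓ :=
  Nat.lt_clog_iff_pow_lt (by norm_num)

open Classical in
/-- The renormalization group decoder: it maps a syndrome to a correcting operator, or to `none`,
which stands for a declared failure. -/
noncomputable def rgDecoder (C : Code D L Qubit Gen) (T : Finset Gen → Pauli Qubit) (ℓ : ℕ)
    (S : Finset Gen) : Option (Pauli Qubit) :=
  if (C.rgState T S (numLevels ℓ)).2 = ∅ then some (C.rgState T S (numLevels ℓ)).1 else none

/-- The decoder corrects the error `P`: given the syndrome of `P` it returns an operator that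
undoes `P` up to a stabilizer. -/
def Corrects (C : Code D L Qubit Gen) (T : Finset Gen → Pauli Qubit) (ℓ : ℕ)
    (P : Pauli Qubit) : Prop :=
  ∃ R, C.rgDecoder T ℓ (C.syndrome P) = some R ∧ P + R ∈ C.stabilizers

/-- A random Pauli operator whose set of affected sites contains every site independently with
probability `ε`.  Nothing is assumed on which nontrivial operators act at those sites. -/
def HasSiteErrorRate (C : Code D L Qubit Gen) (μ : PMF (Pauli Qubit)) (ε : ℝ) : Prop :=
  ∀ E : Finset (Site D L),
    μ.toOuterMeasure {P | C.supp P = E} =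
      ENNReal.ofReal ((1 - ε) ^ (L ^ D - E.card) * ε ^ E.card)

end Code

end TopCode

/-! Errors are organised by scale. A chunk of level `n` has `2 ^ n` sites, diameter at most `16 ^
n`, and for `n > 0` is a union of two disjoint chunks of level `n - 1`. If the error contains no
chunk of level `m`, its support splits into clusters of levels `n < m`, of diameter at most `s = 4 *
16 ^ n`, each at distance more than `2 * s + 4` from every other cluster at least as large
(`exists_chunk_of_mem_residue`, `exists_labelling`).

The decoder treats such clusters independently. A cluster with defects left at level `n` has `2 ^ n
≤ 2 * s + 2`, so connected components never mix clusters (`Progress.defect_far`). Once `2 ^ p ≥ s +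
2`, the remaining defects of a cluster form one neutral component, which TQO2 allows to be removed
(`Progress.step`). In the end each cluster times its own corrections has empty syndrome and fits
into a cube of size `ℓ`, hence is a stabilizer by TQO1 (`IsClustering.corrects`).

There are at most `L ^ D * (900 ^ D) ^ 2 ^ m` chunks of level `m`, each contained in the error with
probability at most `ε ^ 2 ^ m`. The union bound is applied with `16 ^ m` of order `ℓ`, so that `2 ^
m` is at least of order `L ^ (γ / 4)`. -/

namespace TopCode

/-! ### Distances, balls and boxes on the torus -/

section Geometry

variable {D L : ℕ}

theorem cycDist_comm (a b : ZMod L) : cycDist a b = cycDist b a := min_comm _ _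

theorem cycDist_self (a : ZMod L) : cycDist a a = 0 := by simp [cycDist]

theorem cycDist_le_of_val_le [NeZero L] {a b c : ZMod L} {t : ℕ} (ha : (a - c).val ≤ t)
    (hb : (b - c).val ≤ t) : cycDist a b ≤ t := by
  unfold cycDist
  rcases le_total (b - c).val (a - c).val with h | h
  · have := ZMod.val_sub h
    rw [sub_sub_sub_cancel_right] at this
    omega
  · have := ZMod.val_sub h
    rw [sub_sub_sub_cancel_right] at this
    omega

theorem cycDist_triangle [NeZero L] (a b c : ZMod L) : cycDist a c ≤ cycDist a b + cycDist b c := by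
  have h1 := ZMod.val_add_le (a - b) (b - c)
  have h2 := ZMod.val_add_le (c - b) (b - a)
  rw [sub_add_sub_cancel] at h1 h2
  have h3 : (a - b).val ≤ (a - b).val + (c - b).val := by omega
  -- `h1`, `h2` settle two arcs running in the same direction; `h4`, `h5` settle opposite
  -- directions.
  have h4 := cycDist_le_of_val_le (c := b) (a := a) (b := c) (t := max (a - b).val (c - b).val)
    (le_max_left _ _) (le_max_right _ _)
  have h5 : cycDist a c ≤ (b - a).val + (b - c).val := by
    unfold cycDist
    rcases le_total (b - c).val (b - a).val with h | h
    · have := ZMod.val_sub h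
      rw [sub_sub_sub_cancel_left] at this
      omega
    · have := ZMod.val_sub h
      rw [sub_sub_sub_cancel_left] at this
      omega
  unfold cycDist at *
  omega

theorem val_sub_sub_le_of_cycDist_le [NeZero L] {a b : ZMod L} {t : ℕ} (h : cycDist a b ≤ t) :
    (a - (b - (t : ZMod L))).val ≤ 2 * t := by
  have ht : ((t : ℕ) : ZMod L).val ≤ t := by
    rw [ZMod.val_natCast]; exact Nat.mod_le _ _
  unfold cycDist at h
  rcases min_le_iff.1 h with h | h
  · have e : a - (b - (t : ZMod L)) = (a - b) + t := by ring
    rw [e]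
    have := ZMod.val_add_le (a - b) (t : ZMod L)
    omega
  · have e : a - (b - (t : ZMod L)) = ((t - (b - a).val : ℕ) : ZMod L) := by
      rw [Nat.cast_sub h, ZMod.natCast_zmod_val]; ring
    rw [e, ZMod.val_natCast]
    have := Nat.mod_le (t - (b - a).val) L
    omega

theorem torusDist_le_iff {u v : Site D L} {r : ℕ} :
    torusDist u v ≤ r ↔ ∀ i, cycDist (u i) (v i) ≤ r := by
  simp [torusDist, Finset.sup_le_iff]

theorem torusDist_comm (u v : Site D L) : torusDist u v = torusDist v u := by
  simp only [torusDist, cycDist_comm]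

theorem torusDist_self (u : Site D L) : torusDist u u = 0 :=
  Nat.le_zero.1 (torusDist_le_iff.2 fun i => (cycDist_self (u i)).le)

theorem torusDist_triangle [NeZero L] (u v w : Site D L) :
    torusDist u w ≤ torusDist u v + torusDist v w :=
  torusDist_le_iff.2 fun i => (cycDist_triangle _ (v i) _).trans
    (add_le_add (torusDist_le_iff.1 le_rfl i) (torusDist_le_iff.1 le_rfl i))

theorem torusDist_le_one_of_mem_vertices {u c : Site D L} (h : u ∈ vertices c) :
    torusDist u c ≤ 1 := by
  refine torusDist_le_iff.2 fun i => ?_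
  rcases h i with h | h <;> rw [h]
  · simp [cycDist_self]
  · refine (min_le_left _ _).trans ?_
    rw [add_sub_cancel_left, ← Nat.cast_one, ZMod.val_natCast]
    exact Nat.mod_le _ _

/-- The corner of a cube that contains the ball of radius `t` around `v`. -/
def ballCorner (v : Site D L) (t : ℕ) : Site D L := fun i => v i - (t : ZMod L)

theorem mem_siteCube_of_torusDist_le [NeZero L] {u v : Site D L} {t : ℕ} (h : torusDist u v ≤ t) :
    u ∈ siteCube (ballCorner v t) (2 * t) := fun i =>
  val_sub_sub_le_of_cycDist_le (torusDist_le_iff.1 h i)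

theorem siteCube_mono (a : Site D L) {r t : ℕ} (h : r ≤ t) : siteCube a r ⊆ siteCube a t :=
  fun _ hu i => (hu i).trans h

theorem Box.torusDist_le [NeZero L] {B : Box D L} {t : ℕ} (hB : ∀ i, B.side i ≤ t) {c d : Site D L}
    (hc : c ∈ B.cubes) (hd : d ∈ B.cubes) : torusDist c d ≤ t :=
  torusDist_le_iff.2 fun i =>
    cycDist_le_of_val_le ((hc i).trans (hB i)) ((hd i).trans (hB i))

/-- The cube containing the ball around `c` has equal sides, so it competes with `B` under both
conventions. -/
theorem Enclosure.IsMin.side_le [NeZero L] {k : Enclosure} {B : Box D L} {A : Set (Site D L)}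
    (h : k.IsMin B A) {c : Site D L} {t : ℕ} (hA : ∀ d ∈ A, torusDist d c ≤ t) (i : Fin D) :
    B.side i ≤ 2 * t :=
  h.2.2 ⟨ballCorner c t, fun _ => 2 * t⟩ (by cases k <;> simp [Enclosure.Allows])
    (fun d hd => mem_siteCube_of_torusDist_le (hA d hd)) i

theorem card_ball_le [NeZero L] (u : Site D L) (r : ℕ) :
    (Finset.univ.filter fun v : Site D L => torusDist v u ≤ r).card ≤ (2 * r + 1) ^ D := by
  classical
  have hsub : (Finset.univ.filter fun v : Site D L => torusDist v u ≤ r) ⊆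
      Fintype.piFinset fun i =>
        Finset.univ.filter fun x : ZMod L => (x - ballCorner u r i).val ≤ 2 * r := by
    intro v hv
    simp only [Fintype.mem_piFinset, Finset.mem_filter, Finset.mem_univ, true_and] at hv ⊢
    exact mem_siteCube_of_torusDist_le hv
  refine (Finset.card_le_card hsub).trans ?_
  rw [Fintype.card_piFinset]
  refine (Finset.prod_le_pow_card _ _ (2 * r + 1) fun i _ => ?_).trans (by simp)
  rw [← Finset.card_range (2 * r + 1)]
  refine Finset.card_le_card_of_injOn (fun x => (x - ballCorner u r i).val) ?_ ?_
  · intro x hx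
    simp only [Finset.coe_filter, Finset.mem_univ, true_and, Set.mem_ofPred_eq] at hx
    simp only [Finset.coe_range, Set.mem_Iio]
    omega
  · intro x _ y _ hxy
    exact sub_left_injective (ZMod.val_injective L hxy)

end Geometry

namespace Code

/-! ### Supports and syndromes of products -/

section Support

variable {D L : ℕ} {Qubit Gen : Type} [Fintype Qubit] (C : Code D L Qubit Gen)

theorem supp_add (P R : Pauli Qubit) : C.supp (P + R) ⊆ C.supp P ∪ C.supp R := by
  rintro u ⟨x, rfl, hx⟩
  by_cases h : P x = 0
  · exact Or.inr ⟨x, rfl, by simpa [h] using hx⟩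
  · exact Or.inl ⟨x, rfl, h⟩

theorem supp_zero : C.supp 0 = ∅ := by
  ext u; simp [supp]

theorem supp_sum_subset {ι : Type*} {s : Finset ι} {R : ι → Pauli Qubit} {A : Set (Site D L)}
    (h : ∀ i ∈ s, C.supp (R i) ⊆ A) : C.supp (∑ i ∈ s, R i) ⊆ A := by
  rintro u ⟨x, rfl, hx⟩
  rw [Finset.sum_apply] at hx
  obtain ⟨i, hi, hx⟩ := Finset.exists_ne_zero_of_sum_ne_zero hx
  exact h i hi ⟨x, rfl, hx⟩

end Support

section Syndrome

variable {D L : ℕ} {Qubit Gen : Type} [Fintype Qubit]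

theorem symp_add (P R R' : Pauli Qubit) :
    Pauli.symp P (R + R') = Pauli.symp P R + Pauli.symp P R' := by
  simp only [Pauli.symp, ← Finset.sum_add_distrib]
  refine Finset.sum_congr rfl fun x _ => ?_
  simp only [Pi.add_apply, Prod.fst_add, Prod.snd_add]
  ring

theorem symp_zero (P : Pauli Qubit) : Pauli.symp P 0 = 0 := by
  simp [Pauli.symp]

theorem symp_sum {ι : Type*} (s : Finset ι) (P : Pauli Qubit) (R : ι → Pauli Qubit) :
    Pauli.symp P (∑ i ∈ s, R i) = ∑ i ∈ s, Pauli.symp P (R i) := by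
  classical
  induction s using Finset.induction_on with
  | empty => simp [symp_zero]
  | insert a s ha ih => rw [Finset.sum_insert ha, Finset.sum_insert ha, symp_add, ih]

variable [Fintype Gen] (C : Code D L Qubit Gen)

theorem mem_syndrome {P : Pauli Qubit} {g : Gen} :
    g ∈ C.syndrome P ↔ Pauli.symp (C.op g) P ≠ 0 := by
  simp [syndrome]

theorem notMem_syndrome {P : Pauli Qubit} {g : Gen} :
    g ∉ C.syndrome P ↔ Pauli.symp (C.op g) P = 0 := by
  simp [syndrome]

theorem syndrome_zero : C.syndrome 0 = ∅ :=
  Finset.eq_empty_of_forall_notMem fun g => by simp [notMem_syndrome, symp_zero]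

open Classical in
theorem syndrome_add (P R : Pauli Qubit) :
    C.syndrome (P + R) = symmDiff (C.syndrome P) (C.syndrome R) := by
  ext g
  simp only [Finset.mem_symmDiff, mem_syndrome, symp_add]
  generalize Pauli.symp (C.op g) P = a
  generalize Pauli.symp (C.op g) R = b
  revert a b
  decide

theorem syndrome_sum_subset {ι : Type*} {s : Finset ι} {R : ι → Pauli Qubit} {S : Finset Gen}
    (h : ∀ i ∈ s, C.syndrome (R i) ⊆ S) : C.syndrome (∑ i ∈ s, R i) ⊆ S := by
  intro g hg
  by_contra hS
  rw [mem_syndrome, symp_sum] at hg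
  exact hg (Finset.sum_eq_zero fun i hi => C.notMem_syndrome.1 fun h' => hS (h i hi h'))

/-- The syndrome of a product of operators with disjoint syndromes. -/
theorem mem_syndrome_sum {ι : Type*} [Fintype ι] {R : ι → Pauli Qubit}
    (h : ∀ i j g, g ∈ C.syndrome (R i) → g ∈ C.syndrome (R j) → i = j) {g : Gen} :
    g ∈ C.syndrome (∑ i, R i) ↔ ∃ i, g ∈ C.syndrome (R i) := by
  constructor
  · intro hg
    by_contra! hne
    rw [mem_syndrome, symp_sum] at hg
    exact hg (Finset.sum_eq_zero fun i _ => C.notMem_syndrome.1 (hne i))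
  · rintro ⟨i, hi⟩
    rw [mem_syndrome, symp_sum, Finset.sum_eq_single i]
    · exact C.mem_syndrome.1 hi
    · intro j _ hj
      exact C.notMem_syndrome.1 fun h' => hj (h j i g h' hi)
    · simp

/-- An anticommuting generator shares a qubit with `P`, and that qubit sits at a vertex of the
generator's cube. -/
theorem exists_mem_supp_of_mem_syndrome {P : Pauli Qubit} {g : Gen} (h : g ∈ C.syndrome P) :
    ∃ u ∈ C.supp P, torusDist u (C.cube g) ≤ 1 := by
  rw [mem_syndrome] at h
  obtain ⟨x, -, hx⟩ := Finset.exists_ne_zero_of_sum_ne_zero h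
  refine ⟨C.site x, ⟨x, rfl, ?_⟩, torusDist_le_one_of_mem_vertices (C.op_local g x ?_)⟩
  · rintro h0; simp [h0] at hx
  · rintro h0; simp [h0] at hx

end Syndrome

/-! ### `TestNeutral` and connected components -/

section TestNeutral

variable {D L : ℕ} {Qubit Gen : Type} [Fintype Qubit] [Fintype Gen]
  {C : Code D L Qubit Gen} {k : Enclosure} {ℓ : ℕ} {T : Finset Gen → Pauli Qubit}

/-- The returned operator either annihilates the whole cluster or is the identity, so no new defects
appear. -/
theorem IsTestNeutral.syndrome_subset (hT : C.IsTestNeutral k ℓ T) {M : Finset Gen}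
    (hM : M.Nonempty) : C.syndrome (T M) ⊆ M := by
  by_cases h : (C.localAnnihilators k ℓ M).Nonempty
  · obtain ⟨B, -, -, -, h⟩ := (hT M hM).1 h
    exact h.le
  · rw [(hT M hM).2 h, syndrome_zero]; exact Finset.empty_subset _

theorem IsTestNeutral.torusDist_le [NeZero L] (hT : C.IsTestNeutral k ℓ T) {M : Finset Gen} {t : ℕ}
    {g : Gen} (hg : g ∈ M) (hM : ∀ h ∈ M, torusDist (C.cube h) (C.cube g) ≤ t)
    {u : Site D L} (hu : u ∈ C.supp (T M)) : torusDist u (C.cube g) ≤ 2 * t + 1 := by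
  by_cases h : (C.localAnnihilators k ℓ M).Nonempty
  · obtain ⟨B, hB, -, hs, -⟩ := (hT M ⟨g, hg⟩).1 h
    obtain ⟨c, hc, huc⟩ := hs hu
    have h1 := torusDist_le_one_of_mem_vertices huc
    have h2 := Box.torusDist_le (hB.side_le (c := C.cube g) (t := t)
      (by rintro _ ⟨h, hh, rfl⟩; exact hM h hh)) hc (hB.2.1 ⟨g, hg, rfl⟩)
    have := torusDist_triangle u c (C.cube g)
    omega
  · rw [(hT M ⟨g, hg⟩).2 h, supp_zero] at hu
    exact hu.elim

/-- TQO2 supplies an operator on a minimal region, whose sides are at most `2 * t ≤ ℓ`; hence the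
search succeeds, and any operator it finds will do. -/
theorem IsTestNeutral.syndrome_eq [NeZero L] (hT : C.IsTestNeutral k ℓ T) (h2 : C.TQO2 k ℓ)
    {M : Finset Gen} (hM : C.Neutral ℓ M) {t : ℕ} (ht : 2 * t ≤ ℓ)
    {g : Gen} (hg : g ∈ M) (hd : ∀ h ∈ M, torusDist (C.cube h) (C.cube g) ≤ t) :
    C.syndrome (T M) = M := by
  obtain ⟨B, hB, P, hP, hS⟩ := h2 M hM
  have hside := hB.side_le (c := C.cube g) (t := t)
      (by rintro _ ⟨h, hh, rfl⟩; exact hd h hh)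
  obtain ⟨_, -, -, -, h⟩ := (hT M ⟨g, hg⟩).1
    ⟨P, B, hB, (Finset.sup_le fun i _ => hside i).trans ht, hP, hS⟩
  exact h

end TestNeutral

section Components

variable {D L : ℕ} {Qubit Gen : Type} [Fintype Qubit]
  {C : Code D L Qubit Gen}

theorem mem_components {r : ℕ} {S M : Finset Gen} :
    M ∈ C.components r S ↔ M ⊆ S ∧ M.Nonempty ∧ C.IsConn r M ∧
      ∀ M', M' ⊆ S → M ⊆ M' → C.IsConn r M' → M' = M := by
  classical
  simp [components]

theorem isConn_of_torusDist_le {r : ℕ} {M : Finset Gen}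
    (h : ∀ g ∈ M, ∀ g' ∈ M, torusDist (C.cube g) (C.cube g') ≤ r) : C.IsConn r M := by
  rintro A A' ⟨g, hg⟩ ⟨g', hg'⟩ - hu
  refine ⟨g, hg, g', hg', h g ?_ g' ?_⟩
  · have : g ∈ (M : Set Gen) := hu ▸ Or.inl hg
    exact this
  · have : g' ∈ (M : Set Gen) := hu ▸ Or.inr hg'
    exact this

/-- A connected set that meets `N` is contained in `N` if the rest of it is far from `N`. -/
theorem IsConn.subset_of_far {r : ℕ} {M N : Finset Gen} (hM : C.IsConn r M)
    {g : Gen} (hg : g ∈ M) (hgN : g ∈ N)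
    (hfar : ∀ a ∈ N, ∀ b ∈ M, b ∉ N → r < torusDist (C.cube a) (C.cube b)) : M ⊆ N := by
  classical
  by_contra hne
  obtain ⟨b, hb, hbN⟩ := Finset.not_subset.1 hne
  obtain ⟨a, ha, b', hb', hab⟩ := hM ((M : Set Gen) ∩ N) ((M : Set Gen) \ N)
    ⟨g, hg, hgN⟩ ⟨b, hb, hbN⟩
    (Set.disjoint_left.2 fun x hx hx' => hx'.2 hx.2) (Set.inter_union_sdiff _ _)
  exact absurd hab (not_le.2 (hfar a ha.2 b' hb'.1 hb'.2))

end Components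

/-! ### Well separated clusters are corrected independently -/

section Deterministic

variable {D L : ℕ} {Qubit Gen : Type} [Fintype Qubit] {ι : Type} [DecidableEq ι]

/-- The part of `P` on the sites with label `i`. -/
def part (C : Code D L Qubit Gen) (f : Site D L → ι) (P : Pauli Qubit) (i : ι) : Pauli Qubit :=
  fun x => if f (C.site x) = i then P x else 0

theorem sum_part [Fintype ι] (C : Code D L Qubit Gen) (f : Site D L → ι) (P : Pauli Qubit) :
    ∑ i, C.part f P i = P := by
  ext1 x
  simp [part, Finset.sum_apply]

theorem mem_supp_part {C : Code D L Qubit Gen} {f : Site D L → ι} {P : Pauli Qubit} {i : ι}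
    {u : Site D L} : u ∈ C.supp (C.part f P i) ↔ u ∈ C.supp P ∧ f u = i := by
  constructor
  · rintro ⟨x, rfl, hx⟩
    by_cases h : f (C.site x) = i
    · exact ⟨⟨x, rfl, by simpa [part, h] using hx⟩, h⟩
    · simp [part, h] at hx
  · rintro ⟨⟨x, rfl, hx⟩, h⟩
    exact ⟨x, rfl, by simpa [part, h] using hx⟩

/-- A labelling of the support of `P` by clusters of the sizes `s`, which are far from each
other compared to the smaller one of their sizes. -/
structure IsClustering (C : Code D L Qubit Gen) (P : Pauli Qubit) (f : Site D L → ι)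
    (s : ι → ℕ) : Prop where
  near : ∀ u ∈ C.supp P, ∀ v ∈ C.supp P, f u = f v → torusDist u v ≤ s (f u)
  far : ∀ u ∈ C.supp P, ∀ v ∈ C.supp P, f u ≠ f v → s (f u) ≤ s (f v) →
    2 * s (f u) + 4 < torusDist u v

variable [Fintype Gen] [NeZero L] {C : Code D L Qubit Gen} {P : Pauli Qubit} {f : Site D L → ι} {s : ι → ℕ}

/-- Defects lie within distance `1` of their part of the error, so passing from sites to defects
costs `2` in the diameter, and likewise in the separation. -/
theorem IsClustering.defect_near (h : IsClustering C P f s) {i : ι} {g g' : Gen}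
    (hg : g ∈ C.syndrome (C.part f P i)) (hg' : g' ∈ C.syndrome (C.part f P i)) :
    torusDist (C.cube g) (C.cube g') ≤ s i + 2 := by
  obtain ⟨u, hu, hug⟩ := C.exists_mem_supp_of_mem_syndrome hg
  obtain ⟨v, hv, hvg⟩ := C.exists_mem_supp_of_mem_syndrome hg'
  rw [mem_supp_part] at hu hv
  have h1 := h.near u hu.1 v hv.1 (hu.2.trans hv.2.symm)
  rw [hu.2] at h1
  have h2 := torusDist_triangle (C.cube g) u (C.cube g')
  have h3 := torusDist_triangle u v (C.cube g')
  rw [torusDist_comm (C.cube g) u] at h2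
  omega

theorem IsClustering.defect_far (h : IsClustering C P f s) {i j : ι} (hij : i ≠ j)
    (hs : s i ≤ s j) {g g' : Gen}
    (hg : g ∈ C.syndrome (C.part f P i)) (hg' : g' ∈ C.syndrome (C.part f P j)) :
    2 * s i + 2 < torusDist (C.cube g) (C.cube g') := by
  obtain ⟨u, hu, hug⟩ := C.exists_mem_supp_of_mem_syndrome hg
  obtain ⟨v, hv, hvg⟩ := C.exists_mem_supp_of_mem_syndrome hg'
  rw [mem_supp_part] at hu hv
  obtain ⟨hu, rfl⟩ := hu
  obtain ⟨hv, rfl⟩ := hv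
  have h1 := h.far u hu v hv hij hs
  have h2 := torusDist_triangle u (C.cube g) v
  have h3 := torusDist_triangle (C.cube g) (C.cube g') v
  rw [torusDist_comm (C.cube g') v] at h3
  omega

theorem IsClustering.eq_of_mem (h : IsClustering C P f s) {i j : ι} {g : Gen}
    (hg : g ∈ C.syndrome (C.part f P i)) (hg' : g ∈ C.syndrome (C.part f P j)) : i = j := by
  by_contra hij
  rcases le_total (s i) (s j) with hs | hs
  · have := h.defect_far hij hs hg hg'
    rw [torusDist_self] at this
    omega
  · have := h.defect_far (Ne.symm hij) hs hg' hg
    rw [torusDist_self] at this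
    omega

/-- What holds before the level `n`: the accumulated correction is a product of operators `R i`
that are located near the clusters `i` and do not create defects, and the small clusters have
been corrected. -/
structure Progress [Fintype Gen] (C : Code D L Qubit Gen) (P : Pauli Qubit) (f : Site D L → ι) (s : ι → ℕ)
    (n : ℕ) (R : ι → Pauli Qubit) : Prop where
  near : ∀ i, ∀ u ∈ C.supp (R i), ∃ v ∈ C.supp P, f v = i ∧ torusDist u v ≤ 2 * s i + 6
  shrink : ∀ i, C.syndrome (C.part f P i + R i) ⊆ C.syndrome (C.part f P i)
  done : ∀ i, ∀ p < n, s i + 2 ≤ 2 ^ p → C.syndrome (C.part f P i + R i) = ∅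

variable {n : ℕ} {R : ι → Pauli Qubit}

theorem Progress.mem_syndrome_iff [Fintype ι] (h : IsClustering C P f s) (hR : Progress C P f s n R)
    {g : Gen} : g ∈ C.syndrome (P + ∑ i, R i) ↔ ∃ i, g ∈ C.syndrome (C.part f P i + R i) := by
  conv_lhs => rw [← sum_part C f P, ← Finset.sum_add_distrib]
  exact C.mem_syndrome_sum fun i j g hi hj => h.eq_of_mem (hR.shrink i hi) (hR.shrink j hj)

/-- A cluster that still has defects was not finished at level `n - 1`, so `2 ^ (n - 1) < s i + 2`,
that is `2 ^ n ≤ 2 * s i + 2`. This is below the separation guaranteed by the smaller of the two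
clusters. -/
theorem Progress.defect_far (h : IsClustering C P f s) (hR : Progress C P f s n R)
    {i j : ι} (hij : i ≠ j) {g g' : Gen} (hg : g ∈ C.syndrome (C.part f P i + R i))
    (hg' : g' ∈ C.syndrome (C.part f P j + R j)) :
    2 ^ n < torusDist (C.cube g) (C.cube g') := by
  have key : ∀ i, (C.syndrome (C.part f P i + R i)).Nonempty → 2 ^ n ≤ 2 * s i + 2 := by
    intro i hi
    by_contra! hlt
    cases n with
    | zero => simp at hlt
    | succ n =>
      rw [pow_succ] at hlt
      exact hi.ne_empty (hR.done i n (Nat.lt_succ_self n) (by omega))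
  rcases le_total (s i) (s j) with hs | hs
  · exact (key i ⟨g, hg⟩).trans_lt (h.defect_far hij hs (hR.shrink i hg) (hR.shrink j hg'))
  · rw [torusDist_comm]
    exact (key j ⟨g', hg'⟩).trans_lt
      (h.defect_far hij.symm hs (hR.shrink j hg') (hR.shrink i hg))

theorem Progress.subset_of_mem [Fintype ι] (h : IsClustering C P f s) (hR : Progress C P f s n R)
    {M : Finset Gen} (hM : C.IsConn (2 ^ n) M) (hMS : M ⊆ C.syndrome (P + ∑ i, R i))
    {i : ι} {g : Gen} (hg : g ∈ M) (hgi : g ∈ C.syndrome (C.part f P i + R i)) :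
    M ⊆ C.syndrome (C.part f P i + R i) := by
  refine hM.subset_of_far hg hgi fun a ha b hb hbi => ?_
  obtain ⟨j, hj⟩ := (hR.mem_syndrome_iff h).1 (hMS hb)
  refine hR.defect_far h ?_ ha hj
  rintro rfl
  exact hbi hj

theorem Progress.supp_subset_siteCube (h : IsClustering C P f s) (hR : Progress C P f s n R)
    (i : ι) : ∃ a, C.supp (C.part f P i + R i) ⊆ siteCube a (6 * s i + 12) := by
  by_cases hne : ∃ v ∈ C.supp P, f v = i
  · obtain ⟨v, hv, rfl⟩ := hne
    -- Corrections reach `2 * s + 6` from the cluster, whose diameter is `s`.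
    refine ⟨ballCorner v (3 * s (f v) + 6), fun u hu => ?_⟩
    have hd : torusDist u v ≤ 3 * s (f v) + 6 := by
      rcases C.supp_add _ _ hu with hu | hu
      · rw [mem_supp_part] at hu
        have := h.near u hu.1 v hv hu.2
        rw [hu.2] at this
        omega
      · obtain ⟨w, hw, hwv, hd⟩ := hR.near _ u hu
        have h1 := h.near w hw v hv hwv
        rw [hwv] at h1
        have := torusDist_triangle u w v
        omega
    have := mem_siteCube_of_torusDist_le hd
    rwa [show 2 * (3 * s (f v) + 6) = 6 * s (f v) + 12 by ring] at this
  · refine ⟨0, fun u hu => (hne ?_).elim⟩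
    rcases C.supp_add _ _ hu with hu | hu
    · rw [mem_supp_part] at hu
      exact ⟨u, hu⟩
    · obtain ⟨w, hw, hwv, hd⟩ := hR.near _ u hu
      exact ⟨w, hw, hwv⟩

open Classical in
/-- One level of the decoder. -/
theorem Progress.step [Fintype ι] {k : Enclosure} {ℓ : ℕ} {T : Finset Gen → Pauli Qubit}
    (h : IsClustering C P f s) (hs : ∀ u ∈ C.supp P, 6 * s (f u) + 12 ≤ ℓ)
    (h2 : C.TQO2 k ℓ) (hT : C.IsTestNeutral k ℓ T) (hR : Progress C P f s n R) :
    ∃ R' : ι → Pauli Qubit,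
      ∑ i, R' i = ∑ i, R i + C.ec T n (C.syndrome (P + ∑ i, R i)) ∧
      Progress C P f s (n + 1) R' := by
  set S := C.syndrome (P + ∑ i, R i) with hS
  set K := C.components (2 ^ n) S with hK
  have hsub : ∀ M ∈ K, ∃ i, M ⊆ C.syndrome (C.part f P i + R i) := by
    intro M hM
    obtain ⟨hMS, ⟨g, hg⟩, hconn, -⟩ := mem_components.1 hM
    obtain ⟨i, hi⟩ := (hR.mem_syndrome_iff h).1 (hMS hg)
    exact ⟨i, hR.subset_of_mem h hconn hMS hg hi⟩
  have hne : ∀ M ∈ K, M.Nonempty := fun M hM => (mem_components.1 hM).2.1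
  -- Every component belongs to exactly one cluster, so the correction of this level factors over
  -- the clusters.
  let K' : ι → Finset (Finset Gen) := fun i =>
    K.filter fun M => M ⊆ C.syndrome (C.part f P i + R i)
  have hK' : ∀ i M, M ∈ K' i ↔ M ∈ K ∧ M ⊆ C.syndrome (C.part f P i + R i) := by
    intro i M; simp [K']
  have hbU : K = Finset.univ.biUnion K' := by
    ext M
    simp only [Finset.mem_biUnion, Finset.mem_univ, true_and, hK']
    exact ⟨fun hM => (hsub M hM).imp fun i hi => ⟨hM, hi⟩, fun ⟨i, hi⟩ => hi.1⟩
  have hdisj : Set.PairwiseDisjoint ((Finset.univ : Finset ι) : Set ι) K' := by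
    intro i _ j _ hij
    refine Finset.disjoint_left.2 fun M hi hj => hij ?_
    rw [hK'] at hi hj
    obtain ⟨g, hg⟩ := hne M hi.1
    exact h.eq_of_mem (hR.shrink i (hi.2 hg)) (hR.shrink j (hj.2 hg))
  have hsmall : ∀ i, C.syndrome (∑ M ∈ K' i, T M) ⊆ C.syndrome (C.part f P i + R i) := by
    intro i
    refine C.syndrome_sum_subset fun M hM => ?_
    rw [hK'] at hM
    exact (hT.syndrome_subset (hne M hM.1)).trans hM.2
  have hshrink : ∀ i, C.syndrome (C.part f P i + (R i + ∑ M ∈ K' i, T M)) ⊆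
      C.syndrome (C.part f P i + R i) := by
    intro i
    rw [← add_assoc, syndrome_add]
    exact symmDiff_le_sup.trans (Finset.union_subset subset_rfl (hsmall i))
  refine ⟨fun i => R i + ∑ M ∈ K' i, T M, ?_, ⟨?_, ?_, ?_⟩⟩
  · rw [Finset.sum_add_distrib, ec, ← hK, hbU, Finset.sum_biUnion hdisj]
  · intro i u hu
    rcases C.supp_add _ _ hu with hu | hu
    · exact hR.near i u hu
    · have hcov : C.supp (∑ M ∈ K' i, T M) ⊆
          {u | ∃ v ∈ C.supp P, f v = i ∧ torusDist u v ≤ 2 * s i + 6} := by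
        refine C.supp_sum_subset fun M hM u hu => ?_
        rw [hK'] at hM
        have hMi := hM.2.trans (hR.shrink i)
        obtain ⟨g, hg⟩ := hne M hM.1
        have h3 := hT.torusDist_le hg (t := s i + 2)
          (fun g' hg' => h.defect_near (hMi hg') (hMi hg)) hu
        obtain ⟨v, hv, hvg⟩ := C.exists_mem_supp_of_mem_syndrome (hMi hg)
        rw [mem_supp_part] at hv
        refine ⟨v, hv.1, hv.2, ?_⟩
        have := torusDist_triangle u (C.cube g) v
        rw [torusDist_comm (C.cube g) v] at this
        omega
      exact hcov hu
  · exact fun i => (hshrink i).trans (hR.shrink i)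
  · intro i p hp hsp
    by_cases hempty : C.syndrome (C.part f P i + R i) = ∅
    · exact Finset.subset_empty.1 (hempty ▸ hshrink i)
    -- A cluster with defects left cannot have passed the size threshold at an earlier level, so
    -- only the current one matters.
    have hpn : p = n := by
      by_contra hpn
      exact hempty (hR.done i p (by omega) hsp)
    subst hpn
    set N := C.syndrome (C.part f P i + R i) with hN
    obtain ⟨g, hg⟩ := Finset.nonempty_iff_ne_empty.2 hempty
    have hnear : ∀ a ∈ N, ∀ b ∈ N, torusDist (C.cube a) (C.cube b) ≤ s i + 2 :=
      fun a ha b hb => h.defect_near (hR.shrink i ha) (hR.shrink i hb)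
    have hNK : N ∈ K := by
      refine mem_components.2 ⟨fun a ha => (hR.mem_syndrome_iff h).2 ⟨i, ha⟩, ⟨g, hg⟩,
        isConn_of_torusDist_le fun a ha b hb => (hnear a ha b hb).trans hsp, ?_⟩
      intro M' hM'S hNM' hM'
      exact (hR.subset_of_mem h hM' hM'S (hNM' hg) hg).antisymm hNM'
    have hK1 : K' i = {N} := by
      ext M
      rw [hK', Finset.mem_singleton]
      constructor
      · rintro ⟨hM, hMN⟩
        exact ((mem_components.1 hM).2.2.2 N (mem_components.1 hNK).1 hMN
          (mem_components.1 hNK).2.2.1).symm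
      · rintro rfl
        exact ⟨hNK, subset_rfl⟩
    have hsl : 6 * s i + 12 ≤ ℓ := by
      obtain ⟨u, hu, -⟩ := C.exists_mem_supp_of_mem_syndrome (hR.shrink i hg)
      rw [mem_supp_part] at hu
      exact hu.2 ▸ hs u hu.1
    obtain ⟨a, ha⟩ := hR.supp_subset_siteCube h i
    -- `N` is neutral because the cluster, together with the corrections made so far, is itself an
    -- operator of syndrome `N` in a cube of size at most `ℓ`.
    have hTN := hT.syndrome_eq h2 (M := N)
      ⟨_, ⟨a, ha.trans (siteCube_mono a hsl)⟩, hN.symm⟩ (t := s i + 2) (by omega) hg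
      (fun b hb => hnear b hb g hg)
    rw [hK1, Finset.sum_singleton, ← add_assoc, syndrome_add, hTN, ← hN, symmDiff_self]
    rfl

open Classical in
/-- The decoder corrects an error whose support splits into well separated clusters that are
small compared to `ℓ`. -/
theorem IsClustering.corrects [Fintype ι] {k : Enclosure} {ℓ : ℕ} {T : Finset Gen → Pauli Qubit}
    (h : IsClustering C P f s) (hs : ∀ u ∈ C.supp P, 6 * s (f u) + 12 ≤ ℓ)
    (h1 : C.TQO1 ℓ) (h2 : C.TQO2 k ℓ) (hT : C.IsTestNeutral k ℓ T) :
    C.Corrects T ℓ P := by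
  have main : ∀ n, ∃ R : ι → Pauli Qubit, (C.rgState T (C.syndrome P) n).1 = ∑ i, R i ∧
      (C.rgState T (C.syndrome P) n).2 = C.syndrome (P + ∑ i, R i) ∧
      Progress C P f s n R := by
    intro n
    induction n with
    | zero =>
      refine ⟨fun _ => 0, by simp [rgState], by simp [rgState], ⟨?_, ?_, ?_⟩⟩
      · intro i u hu
        simp [supp_zero] at hu
      · intro i; rw [add_zero]
      · intro i p hp; omega
    | succ n ih =>
      obtain ⟨R, hR1, hR2, hR⟩ := ih
      obtain ⟨R', hR', hP⟩ := hR.step h hs h2 hT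
      refine ⟨R', ?_, ?_, hP⟩
      · simp only [rgState, hR1, hR2, hR']
      · simp only [rgState, hR2]
        rw [hR', ← add_assoc, C.syndrome_add (P + ∑ i, R i)]
  obtain ⟨R, hR1, hR2, hR⟩ := main (numLevels ℓ)
  have hdone : ∀ i, C.syndrome (C.part f P i + R i) = ∅ := by
    intro i
    by_contra hne
    obtain ⟨g, hg⟩ := Finset.nonempty_iff_ne_empty.2 hne
    obtain ⟨u, hu, -⟩ := C.exists_mem_supp_of_mem_syndrome (hR.shrink i hg)
    rw [mem_supp_part] at hu
    have hsl : 6 * s i + 12 ≤ ℓ := hu.2 ▸ hs u hu.1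
    -- For the least `p` with `s i + 2 ≤ 2 ^ p` one has `2 ^ p < 2 * (s i + 2) ≤ ℓ`, so the decoder
    -- does run this level.
    refine hne (hR.done i (Nat.clog 2 (s i + 2)) ?_ (Nat.le_pow_clog (by norm_num) _))
    rw [lt_numLevels_iff]
    have := Nat.pow_pred_clog_lt_self (b := 2) (by norm_num) (x := s i + 2) (by omega)
    obtain ⟨m, hm⟩ : ∃ m, Nat.clog 2 (s i + 2) = m + 1 :=
      Nat.exists_eq_succ_of_ne_zero (Nat.clog_pos (by norm_num) (by omega)).ne'
    rw [hm, Nat.pred_succ] at this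
    rw [hm, pow_succ]
    omega
  have hempty : C.syndrome (P + ∑ i, R i) = ∅ := by
    refine Finset.eq_empty_of_forall_notMem fun g hg => ?_
    obtain ⟨i, hi⟩ := (hR.mem_syndrome_iff h).1 hg
    simp [hdone i] at hi
  refine ⟨∑ i, R i, ?_, ?_⟩
  · rw [rgDecoder, if_pos (hR2.trans hempty), hR1]
  · rw [← sum_part C f P, ← Finset.sum_add_distrib]
    refine AddSubgroup.sum_mem _ fun i _ => ?_
    by_cases hi : ∃ u ∈ C.supp P, f u = i
    · obtain ⟨u, hu, rfl⟩ := hi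
      obtain ⟨a, ha⟩ := hR.supp_subset_siteCube h (f u)
      exact h1 _ (hdone _) ⟨a, ha.trans (siteCube_mono a (hs u hu))⟩
    · refine h1 _ (hdone i) ⟨0, fun u hu => (hi ?_).elim⟩
      rcases C.supp_add _ _ hu with hu | hu
      · rw [mem_supp_part] at hu
        exact ⟨u, hu⟩
      · obtain ⟨w, hw, hwv, hd⟩ := hR.near _ u hu
        exact ⟨w, hw, hwv⟩

end Deterministic

end Code

/-! ### Chunk decomposition and counting of chunks -/

section Chunks

variable {D L : ℕ}

/-- Chunks of level `n` are made of `2 ^ n` sites by pairing chunks of lower levels that are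
close to each other. -/
def IsChunk : ℕ → Finset (Site D L) → Prop
  | 0, A => ∃ u, A = {u}
  | n + 1, A => ∃ A₁ A₂, IsChunk n A₁ ∧ IsChunk n A₂ ∧ Disjoint A₁ A₂ ∧
      (∀ u, u ∈ A ↔ u ∈ A₁ ∨ u ∈ A₂) ∧ ∀ u ∈ A, ∀ v ∈ A, torusDist u v ≤ 16 ^ (n + 1)

theorem IsChunk.card_eq {n : ℕ} {A : Finset (Site D L)} (h : IsChunk n A) : A.card = 2 ^ n := by
  classical
  induction n generalizing A with
  | zero => obtain ⟨u, rfl⟩ := h; simp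
  | succ n ih =>
    obtain ⟨A₁, A₂, h₁, h₂, hd, hA, -⟩ := h
    have : A = A₁ ∪ A₂ := by ext u; simp [hA]
    rw [this, Finset.card_union_of_disjoint hd, ih h₁, ih h₂, pow_succ]
    ring

theorem IsChunk.torusDist_le {n : ℕ} {A : Finset (Site D L)} (h : IsChunk n A)
    {u v : Site D L} (hu : u ∈ A) (hv : v ∈ A) : torusDist u v ≤ 16 ^ n := by
  cases n with
  | zero =>
    obtain ⟨w, rfl⟩ := h
    rw [Finset.mem_singleton] at hu hv
    rw [hu, hv, torusDist_self]
    exact Nat.zero_le _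
  | succ n =>
    obtain ⟨-, -, -, -, -, -, hA⟩ := h
    exact hA u hu v hv

/-- `M` is a cluster of level `n` in `X`: it is small and far from the rest of `X`. -/
structure IsIsolated (n : ℕ) (X M : Finset (Site D L)) : Prop where
  subset : M ⊆ X
  near : ∀ u ∈ M, ∀ v ∈ M, torusDist u v ≤ 4 * 16 ^ n
  far : ∀ u ∈ M, ∀ v ∈ X, v ∉ M → 2 * (4 * 16 ^ n) + 4 < torusDist u v

/-- The diameter of one isolated set is smaller than the distance from the other to its complement.
-/
theorem IsIsolated.eq_of_mem {n : ℕ} {X M N : Finset (Site D L)} (hM : IsIsolated n X M)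
    (hN : IsIsolated n X N) {u : Site D L} (huM : u ∈ M) (huN : u ∈ N) : M = N := by
  refine Finset.Subset.antisymm (fun v hv => ?_) fun v hv => ?_
  · by_contra h
    have := hM.near u huM v hv
    have := hN.far u huN v (hM.subset hv) h
    omega
  · by_contra h
    have := hN.near u huN v hv
    have := hM.far u huM v (hN.subset hv) h
    omega

open Classical in
/-- The part of `E` that is left when the clusters of the levels below `n` have been removed
successively. -/
noncomputable def residue (E : Finset (Site D L)) : ℕ → Finset (Site D L)
  | 0 => E
  | n + 1 => (residue E n).filter fun u => ¬ ∃ M, IsIsolated n (residue E n) M ∧ u ∈ M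

theorem mem_residue_succ {E : Finset (Site D L)} {n : ℕ} {u : Site D L} :
    u ∈ residue E (n + 1) ↔
      u ∈ residue E n ∧ ¬ ∃ M, IsIsolated n (residue E n) M ∧ u ∈ M := by
  classical
  rw [residue, Finset.mem_filter]

theorem residue_anti (E : Finset (Site D L)) : Antitone (residue E) :=
  antitone_nat_of_succ_le fun _ _ hu => (mem_residue_succ.1 hu).1

/-- If no remaining site has distance between `2 * 16 ^ n` and `10 * 16 ^ n + 4` from `u`, the ball
of radius `2 * 16 ^ n` is isolated and `u` is removed. Otherwise chunks through `u` and such a site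
`v` are disjoint, and their union has diameter at most `12 * 16 ^ n + 4 ≤ 16 ^ (n + 1)`, with
equality at `n = 0`. -/
theorem exists_chunk_of_mem_residue [NeZero L] {E : Finset (Site D L)} {n : ℕ} {u : Site D L}
    (hu : u ∈ residue E n) : ∃ A, IsChunk n A ∧ A ⊆ E ∧ u ∈ A := by
  classical
  induction n generalizing u with
  | zero => exact ⟨{u}, ⟨u, rfl⟩, Finset.singleton_subset_iff.2 hu, Finset.mem_singleton_self u⟩
  | succ n ih =>
    rw [mem_residue_succ] at hu
    obtain ⟨hu, hiso⟩ := hu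
    obtain ⟨v, hv, h1, h2⟩ : ∃ v ∈ residue E n, 2 * 16 ^ n < torusDist u v ∧
        torusDist u v ≤ 10 * 16 ^ n + 4 := by
      by_contra! hno
      refine hiso ⟨(residue E n).filter fun v => torusDist u v ≤ 2 * 16 ^ n,
        ⟨Finset.filter_subset _ _, ?_, ?_⟩, ?_⟩
      · intro v hv w hw
        rw [Finset.mem_filter] at hv hw
        have := torusDist_triangle v u w
        rw [torusDist_comm v u] at this
        omega
      · intro v hv w hw hw'
        rw [Finset.mem_filter] at hv
        have h1 : 2 * 16 ^ n < torusDist u w := by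
          by_contra hle
          exact hw' (Finset.mem_filter.2 ⟨hw, not_lt.1 hle⟩)
        have h2 := hno w hw h1
        have := torusDist_triangle u v w
        omega
      · rw [Finset.mem_filter, torusDist_self]
        exact ⟨hu, Nat.zero_le _⟩
    obtain ⟨A, hA, hAE, huA⟩ := ih hu
    obtain ⟨B, hB, hBE, hvB⟩ := ih hv
    have hpos : 1 ≤ 16 ^ n := Nat.one_le_pow _ _ (by norm_num)
    have hAB : ∀ a ∈ A, ∀ b ∈ B, torusDist a b ≤ 16 ^ (n + 1) := by
      intro a ha b hb
      have h3 := hA.torusDist_le ha huA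
      have h4 := hB.torusDist_le hvB hb
      have h5 := torusDist_triangle a u b
      have h6 := torusDist_triangle u v b
      rw [pow_succ]
      omega
    refine ⟨A ∪ B, ⟨A, B, hA, hB, ?_, fun w => Finset.mem_union, ?_⟩,
      Finset.union_subset hAE hBE, Finset.mem_union_left _ huA⟩
    · refine Finset.disjoint_left.2 fun w hwA hwB => ?_
      have h3 := hA.torusDist_le huA hwA
      have h4 := hB.torusDist_le hwB hvB
      have h5 := torusDist_triangle u w v
      omega
    · intro a ha b hb
      rw [Finset.mem_union] at ha hb
      rw [pow_succ]
      rcases ha with ha | ha <;> rcases hb with hb | hb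
      · have := hA.torusDist_le ha hb; omega
      · rw [← pow_succ]; exact hAB a ha b hb
      · rw [← pow_succ, torusDist_comm]; exact hAB b hb a ha
      · have := hB.torusDist_le ha hb; omega

/-- A set of sites without chunks of level `m` splits into well separated clusters. -/
theorem exists_labelling [NeZero L] {E : Finset (Site D L)} {m : ℕ}
    (h : ∀ A, IsChunk m A → ¬ A ⊆ E) :
    ∃ f : Site D L → Fin (m + 1) × Finset (Site D L),
      (∀ u ∈ E, ((f u).1 : ℕ) < m) ∧
      (∀ u ∈ E, ∀ v ∈ E, f u = f v → torusDist u v ≤ 4 * 16 ^ ((f u).1 : ℕ)) ∧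
      ∀ u ∈ E, ∀ v ∈ E, f u ≠ f v → (f u).1 ≤ (f v).1 →
        2 * (4 * 16 ^ ((f u).1 : ℕ)) + 4 < torusDist u v := by
  classical
  have hm : residue E m = ∅ := Finset.eq_empty_of_forall_notMem fun u hu => by
    obtain ⟨A, hA, hAE, -⟩ := exists_chunk_of_mem_residue hu
    exact h A hA hAE
  -- The label of a site is the level at which it is removed and the isolated set removed with it.
  -- `Fin (m + 1)` keeps the label type nonempty even for `m = 0`.
  have hlab : ∀ u ∈ E, ∃ x : Fin (m + 1) × Finset (Site D L), (x.1 : ℕ) < m ∧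
      IsIsolated (x.1 : ℕ) (residue E x.1) x.2 ∧ u ∈ x.2 := by
    intro u hu
    have hex : ∃ n, u ∉ residue E n := ⟨m, by simp [hm]⟩
    have hspec := Nat.find_spec hex
    have hle : Nat.find hex ≤ m := Nat.find_min' hex (by simp [hm])
    obtain ⟨n, hn⟩ : ∃ n, Nat.find hex = n + 1 := by
      refine Nat.exists_eq_succ_of_ne_zero fun h0 => ?_
      rw [h0] at hspec
      exact hspec hu
    have hun : u ∈ residue E n := not_not.1 (Nat.find_min hex (by omega))
    rw [hn, mem_residue_succ] at hspec
    obtain ⟨M, hM, huM⟩ : ∃ M, IsIsolated n (residue E n) M ∧ u ∈ M := by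
      by_contra hno
      exact hspec ⟨hun, hno⟩
    exact ⟨(⟨n, by omega⟩, M), by simp only; omega, hM, huM⟩
  choose! f hf1 hf2 hf3 using hlab
  refine ⟨f, hf1, ?_, ?_⟩
  · intro u hu v hv huv
    exact (hf2 u hu).near u (hf3 u hu) v (huv ▸ hf3 v hv)
  · intro u hu v hv huv hle
    have hvr : v ∈ residue E ((f u).1 : ℕ) :=
      residue_anti E (Fin.le_def.1 hle) ((hf2 v hv).subset (hf3 v hv))
    refine (hf2 u hu).far u (hf3 u hu) v hvr fun hvM => huv ?_
    -- A site of the isolated set of `u` is removed no later than `u`.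
    have hlt : ((f v).1 : ℕ) < (f u).1 + 1 := by
      by_contra! hge
      exact (mem_residue_succ.1 (residue_anti E hge ((hf2 v hv).subset (hf3 v hv)))).2
        ⟨_, hf2 u hu, hvM⟩
    have h1 : (f u).1 = (f v).1 := Fin.ext (by have := Fin.le_def.1 hle; omega)
    have h2 := hf2 v hv
    rw [← h1] at h2
    exact Prod.ext h1 ((hf2 u hu).eq_of_mem h2 hvM (hf3 v hv))

open Classical in
/-- The chunks of level `n`. -/
noncomputable def chunks (D L : ℕ) [NeZero L] (n : ℕ) : Finset (Finset (Site D L)) :=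
  Finset.univ.filter (IsChunk n)

open Classical in
/-- The chunks of level `n` that contain `u`. -/
noncomputable def chunksAt {D L : ℕ} [NeZero L] (n : ℕ) (u : Site D L) :
    Finset (Finset (Site D L)) :=
  Finset.univ.filter fun A => IsChunk n A ∧ u ∈ A

/-- A chunk at `u` is the union of a lower chunk at `u` and a lower chunk through some site `v` of
the ball around `u`. -/
theorem card_chunksAt_succ_le [NeZero L] {n c : ℕ}
    (hc : ∀ v : Site D L, (chunksAt n v).card ≤ c) (u : Site D L) :
    (chunksAt (n + 1) u).card ≤ (3 * 16 ^ (n + 1)) ^ D * c ^ 2 := by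
  classical
  set ball := Finset.univ.filter fun v : Site D L => torusDist v u ≤ 16 ^ (n + 1)
  have hball : ball.card ≤ (3 * 16 ^ (n + 1)) ^ D := by
    refine (card_ball_le u _).trans (Nat.pow_le_pow_left ?_ _)
    have : 1 ≤ 16 ^ (n + 1) := Nat.one_le_pow _ _ (by norm_num)
    omega
  have hsub : chunksAt (n + 1) u ⊆
      ((chunksAt n u) ×ˢ (ball.biUnion (chunksAt n))).image fun x => x.1 ∪ x.2 := by
    intro A hA
    rw [chunksAt, Finset.mem_filter] at hA
    obtain ⟨-, ⟨A₁, A₂, h₁, h₂, -, hA, hdiam⟩, hu⟩ := hA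
    have key : ∀ B₁ B₂, IsChunk n B₁ → IsChunk n B₂ → (∀ u, u ∈ A ↔ u ∈ B₁ ∨ u ∈ B₂) → u ∈ B₁ →
        A ∈ ((chunksAt n u) ×ˢ (ball.biUnion (chunksAt n))).image fun x => x.1 ∪ x.2 := by
      intro B₁ B₂ hB₁ hB₂ hB huB
      obtain ⟨v, hv⟩ : B₂.Nonempty := by
        rw [← Finset.card_pos, hB₂.card_eq]; positivity
      refine Finset.mem_image.2 ⟨(B₁, B₂), ?_, by ext w; simp [hB]⟩
      simp only [Finset.mem_product, Finset.mem_biUnion, chunksAt, Finset.mem_filter,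
        Finset.mem_univ, true_and, ball]
      exact ⟨⟨hB₁, huB⟩, v, hdiam v ((hB v).2 (Or.inr hv)) u hu, hB₂, hv⟩
    rcases (hA u).1 hu with h | h
    · exact key A₁ A₂ h₁ h₂ hA h
    · exact key A₂ A₁ h₂ h₁ (fun u => (hA u).trans or_comm) h
  refine (Finset.card_le_card hsub).trans (Finset.card_image_le.trans ?_)
  rw [Finset.card_product]
  have h1 : (ball.biUnion (chunksAt n)).card ≤ (3 * 16 ^ (n + 1)) ^ D * c :=
    (Finset.card_biUnion_le_card_mul _ _ c fun v _ => hc v).trans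
      (Nat.mul_le_mul_right _ hball)
  calc _ ≤ c * ((3 * 16 ^ (n + 1)) ^ D * c) := Nat.mul_le_mul (hc u) h1
    _ = _ := by ring

/-- The weight `(3 * 16 ^ (n + 2)) ^ D` turns the recursion for `c` into exact squaring, starting
from `(3 * 16 ^ 2) ^ D = 768 ^ D`. -/
theorem exists_card_chunksAt_le (D L : ℕ) [NeZero L] (n : ℕ) :
    ∃ c : ℕ, (∀ u : Site D L, (chunksAt n u).card ≤ c) ∧
      c * (3 * 16 ^ (n + 2)) ^ D ≤ (768 ^ D) ^ 2 ^ n := by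
  classical
  induction n with
  | zero =>
    refine ⟨1, fun u => ?_, by norm_num⟩
    have : chunksAt 0 u ⊆ {{u}} := by
      intro A hA
      rw [chunksAt, Finset.mem_filter] at hA
      obtain ⟨-, ⟨v, rfl⟩, hu⟩ := hA
      rw [Finset.mem_singleton] at hu ⊢
      rw [hu]
    exact (Finset.card_le_card this).trans (by simp)
  | succ n ih =>
    obtain ⟨c, hc, hle⟩ := ih
    refine ⟨(3 * 16 ^ (n + 1)) ^ D * c ^ 2, card_chunksAt_succ_le hc, ?_⟩
    calc (3 * 16 ^ (n + 1)) ^ D * c ^ 2 * (3 * 16 ^ (n + 1 + 2)) ^ D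
        = (c * (3 * 16 ^ (n + 2)) ^ D) ^ 2 := by
          have : (3 * 16 ^ (n + 1)) * (3 * 16 ^ (n + 1 + 2)) = (3 * 16 ^ (n + 2)) ^ 2 := by ring
          rw [mul_right_comm, ← mul_pow, this]
          generalize 3 * 16 ^ (n + 2) = x
          ring
      _ ≤ ((768 ^ D) ^ 2 ^ n) ^ 2 := Nat.pow_le_pow_left hle 2
      _ = _ := by rw [← pow_mul, ← pow_succ]

theorem card_site (D L : ℕ) [NeZero L] : Fintype.card (Site D L) = L ^ D := by
  simp [ZMod.card]

theorem card_chunks_le (D L : ℕ) [NeZero L] (n : ℕ) :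
    (chunks D L n).card ≤ L ^ D * (900 ^ D) ^ 2 ^ n := by
  classical
  obtain ⟨c, hc, hle⟩ := exists_card_chunksAt_le D L n
  have hsub : chunks D L n ⊆ Finset.univ.biUnion (chunksAt n) := by
    intro A hA
    rw [chunks, Finset.mem_filter] at hA
    obtain ⟨v, hv⟩ : A.Nonempty := by
      rw [← Finset.card_pos, hA.2.card_eq]; positivity
    simp only [Finset.mem_biUnion, chunksAt, Finset.mem_filter, Finset.mem_univ, true_and]
    exact ⟨v, hA.2, hv⟩
  refine (Finset.card_le_card hsub).trans
    ((Finset.card_biUnion_le_card_mul _ _ c fun v _ => hc v).trans ?_)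
  rw [Finset.card_univ, card_site]
  refine Nat.mul_le_mul_left _ ?_
  calc c ≤ c * (3 * 16 ^ (n + 2)) ^ D := Nat.le_mul_of_pos_right _ (by positivity)
    _ ≤ (768 ^ D) ^ 2 ^ n := hle
    _ ≤ _ := by gcongr; norm_num

end Chunks

/-! ### Failure probability by a union bound over chunks -/

namespace Code

variable {D L : ℕ} {Qubit Gen : Type} [Fintype Qubit]

open Classical in
/-- The sites of a given set are all affected with probability at most `ε ^ #A`. -/
theorem HasSiteErrorRate.measure_subset_le [NeZero L] {C : Code D L Qubit Gen}
    {μ : PMF (Pauli Qubit)} {ε : ℝ} (h : C.HasSiteErrorRate μ ε) (h0 : 0 ≤ ε) (h1 : ε ≤ 1)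
    (A : Finset (Site D L)) :
    μ.toOuterMeasure {P | (A : Set (Site D L)) ⊆ C.supp P} ≤ ENNReal.ofReal (ε ^ A.card) := by
  -- The event is split by the affected sites `F` outside `A`; by the binomial theorem their weights
  -- sum to `1`.
  have hsub : {P | (A : Set (Site D L)) ⊆ C.supp P} ⊆
      ⋃ F ∈ Aᶜ.powerset, {P | C.supp P = ((A ∪ F : Finset (Site D L)) : Set (Site D L))} := by
    intro P hP
    refine Set.mem_biUnion (x := Aᶜ.filter fun u => u ∈ C.supp P)
      (Finset.mem_powerset.2 (Finset.filter_subset _ _)) ?_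
    change C.supp P = _
    ext u
    simp only [Finset.coe_union, Set.mem_union, SetLike.mem_coe, Finset.mem_filter,
      Finset.mem_compl]
    by_cases hu : u ∈ A
    · simp [hu, hP hu]
    · simp [hu]
  refine (MeasureTheory.measure_mono hsub).trans
    ((MeasureTheory.measure_biUnion_finset_le _ _).trans ?_)
  have hterm : ∀ F ∈ Aᶜ.powerset,
      μ.toOuterMeasure {P | C.supp P = ((A ∪ F : Finset (Site D L)) : Set (Site D L))} =
        ENNReal.ofReal (ε ^ A.card * (ε ^ F.card * (1 - ε) ^ (Aᶜ.card - F.card))) := by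
    intro F hF
    have hd : Disjoint A F :=
      Finset.disjoint_left.2 fun u hu hu' => Finset.mem_compl.1 (Finset.mem_powerset.1 hF hu') hu
    rw [h, Finset.card_union_of_disjoint hd, Finset.card_compl, card_site, Nat.sub_sub]
    congr 1
    ring
  rw [Finset.sum_congr rfl hterm, ← ENNReal.ofReal_sum_of_nonneg, ← Finset.mul_sum,
    Finset.sum_pow_mul_eq_add_pow, add_sub_cancel, one_pow, mul_one]
  intro F _
  have : 0 ≤ 1 - ε := by linarith
  positivity

variable [Fintype Gen]

open Classical in
-- Cluster sizes are at most `4 * 16 ^ m`, and `6 * (4 * 16 ^ m) + 12 ≤ 36 * 16 ^ m`.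
theorem corrects_of_forall_chunk [NeZero L] {C : Code D L Qubit Gen} {k : Enclosure} {ℓ m : ℕ}
    {T : Finset Gen → Pauli Qubit} (hm : 36 * 16 ^ m ≤ ℓ)
    (h1 : C.TQO1 ℓ) (h2 : C.TQO2 k ℓ) (hT : C.IsTestNeutral k ℓ T) {P : Pauli Qubit}
    (hP : ∀ A ∈ chunks D L m, ¬ (A : Set (Site D L)) ⊆ C.supp P) : C.Corrects T ℓ P := by
  have hE : ∀ u, u ∈ (C.supp P).toFinset ↔ u ∈ C.supp P := fun u => Set.mem_toFinset
  obtain ⟨f, hf1, hf2, hf3⟩ := exists_labelling (E := (C.supp P).toFinset) (m := m)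
    fun A hA hAE => hP A (by simpa [chunks] using hA) fun u hu => (hE u).1 (hAE hu)
  simp only [hE] at hf1 hf2 hf3
  have hcl : IsClustering C P f fun x => 4 * 16 ^ (x.1 : ℕ) := by
    refine ⟨hf2, fun u hu v hv huv hle => hf3 u hu v hv huv ?_⟩
    exact Fin.le_def.2 ((Nat.pow_le_pow_iff_right (by norm_num : 1 < 16)).1
      (Nat.le_of_mul_le_mul_left hle (by norm_num)))
  refine hcl.corrects (fun u hu => ?_) h1 h2 hT
  have h3 : 16 ^ ((f u).1 : ℕ) ≤ 16 ^ m := Nat.pow_le_pow_right (by norm_num) (hf1 u hu).le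
  have h4 : 1 ≤ 16 ^ m := Nat.one_le_pow _ _ (by norm_num)
  omega

open Classical in
theorem measure_not_corrects_le [NeZero L] {C : Code D L Qubit Gen} {k : Enclosure} {ℓ m : ℕ}
    {T : Finset Gen → Pauli Qubit} (hm : 36 * 16 ^ m ≤ ℓ)
    (h1 : C.TQO1 ℓ) (h2 : C.TQO2 k ℓ) (hT : C.IsTestNeutral k ℓ T)
    {μ : PMF (Pauli Qubit)} {ε : ℝ} (h : C.HasSiteErrorRate μ ε) (hε0 : 0 ≤ ε) (hε1 : ε ≤ 1) :
    μ.toOuterMeasure {P | ¬ C.Corrects T ℓ P} ≤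
      ENNReal.ofReal ((L : ℝ) ^ D * (900 ^ D * ε) ^ 2 ^ m) := by
  have hsub : {P | ¬ C.Corrects T ℓ P} ⊆
      ⋃ A ∈ chunks D L m, {P | (A : Set (Site D L)) ⊆ C.supp P} := by
    intro P hP
    by_contra hno
    refine hP (corrects_of_forall_chunk hm h1 h2 hT fun A hA hAP => hno ?_)
    exact Set.mem_biUnion (x := A) hA hAP
  refine (MeasureTheory.measure_mono hsub).trans
    ((MeasureTheory.measure_biUnion_finset_le _ _).trans ?_)
  have hterm : ∀ A ∈ chunks D L m,
      μ.toOuterMeasure {P | (A : Set (Site D L)) ⊆ C.supp P} ≤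
        ENNReal.ofReal (ε ^ 2 ^ m) := by
    intro A hA
    have hA' : IsChunk m A := by simpa [chunks] using hA
    rw [← hA'.card_eq]
    exact h.measure_subset_le hε0 hε1 A
  refine (Finset.sum_le_sum hterm).trans ?_
  rw [Finset.sum_const, nsmul_eq_mul, ← ENNReal.ofReal_natCast,
    ← ENNReal.ofReal_mul (Nat.cast_nonneg _)]
  refine ENNReal.ofReal_le_ofReal ?_
  rw [mul_pow, ← mul_assoc]
  refine mul_le_mul_of_nonneg_right ?_ (by positivity)
  exact_mod_cast card_chunks_le D L m

end Code

/-! ### Choice of the level -/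

/-- The level up to which the error has to be free of chunks, and the resulting bound. -/
theorem exists_level_bound (D : ℕ) {γ θ : ℝ} (hγ : 0 < γ) (hθ0 : 0 ≤ θ) (hθ1 : θ < 1) :
    ∃ c : ℝ, 0 < c ∧ ∃ L₀ : ℕ, ∀ L : ℕ, 0 < L → L₀ ≤ L → ∀ ℓ : ℕ, (L : ℝ) ^ γ ≤ (ℓ : ℝ) →
      ∃ m : ℕ, 36 * 16 ^ m ≤ ℓ ∧
        (L : ℝ) ^ D * θ ^ 2 ^ m ≤ Real.exp (-(c * (L : ℝ) ^ (γ / 4))) := by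
  obtain ⟨a, ha, hθa⟩ : ∃ a : ℝ, 0 < a ∧ θ ≤ Real.exp (-a) := by
    -- The maximum with `1 / 2` makes the logarithm usable when `θ = 0`.
    have h0 : (0 : ℝ) < max θ (1 / 2) := lt_max_of_lt_right (by norm_num)
    refine ⟨-Real.log (max θ (1 / 2)), ?_, ?_⟩
    · rw [neg_pos]
      exact Real.log_neg h0 (max_lt hθ1 (by norm_num))
    · rw [neg_neg, Real.exp_log h0]
      exact le_max_left _ _
  have hη : 0 < γ / 4 := by positivity
  have e1 : ∀ᶠ x : ℝ in Filter.atTop, 36 ≤ x ^ γ :=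
    (tendsto_rpow_atTop hγ).eventually_ge_atTop 36
  have e2 := (isLittleO_log_rpow_atTop hη).bound (c := a / (10 * (D + 1))) (by positivity)
  obtain ⟨L₀, hL₀⟩ := Filter.eventually_atTop.1
    (tendsto_natCast_atTop_atTop.eventually (e1.and e2))
  refine ⟨a / 10, by positivity, L₀, fun L hL hLL ℓ hℓ => ?_⟩
  obtain ⟨h1, h2⟩ := hL₀ L hLL
  have hLpos : (0 : ℝ) < L := Nat.cast_pos.2 hL
  set y := (L : ℝ) ^ (γ / 4) with hy
  have hypos : 0 < y := Real.rpow_pos_of_pos hLpos _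
  have hy4 : y ^ 4 = (L : ℝ) ^ γ := by
    rw [hy, ← Real.rpow_natCast, ← Real.rpow_mul hLpos.le]
    congr 1
    norm_num
  have hℓ36 : 36 ≤ ℓ := by exact_mod_cast h1.trans hℓ
  refine ⟨Nat.log 16 (ℓ / 36), ?_, ?_⟩
  · have := Nat.pow_log_le_self 16 (x := ℓ / 36) (by omega)
    omega
  set m := Nat.log 16 (ℓ / 36) with hm
  have hlt : ℓ < 576 * (2 ^ m) ^ 4 := by
    have := Nat.lt_pow_succ_log_self (b := 16) (by norm_num) (ℓ / 36)
    rw [← hm, pow_succ] at this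
    have e : (2 ^ m) ^ 4 = 16 ^ m := by rw [pow_right_comm]; norm_num
    omega
  have hlt' : (ℓ : ℝ) < 576 * ((2 : ℝ) ^ m) ^ 4 := by exact_mod_cast hlt
  -- By maximality of `m`, `ℓ < 36 * 16 ^ (m + 1) = 576 * (2 ^ m) ^ 4`, and `576 ≤ 5 ^ 4`.
  have hyle : y ≤ 5 * 2 ^ m := by
    refine le_of_pow_le_pow_left₀ (n := 4) (by norm_num) (by positivity) ?_
    rw [hy4, mul_pow]
    have : (0 : ℝ) ≤ ((2 : ℝ) ^ m) ^ 4 := by positivity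
    linarith
  have hLD : (L : ℝ) ^ D ≤ Real.exp (a / 10 * y) := by
    rw [← Real.exp_log hLpos, ← Real.exp_nat_mul, Real.exp_le_exp]
    have h3 : Real.log L ≤ a / (10 * (D + 1)) * y := by
      have := (Real.le_norm_self _).trans h2
      rwa [Real.norm_of_nonneg hypos.le] at this
    have h4 : (D : ℝ) * Real.log L ≤ (D + 1) * (a / (10 * (D + 1)) * y) := by
      refine mul_le_mul (by linarith) h3 (Real.log_nonneg ?_) (by positivity)
      exact_mod_cast hL
    refine h4.trans (le_of_eq ?_)
    field_simp
  have hθm : θ ^ 2 ^ m ≤ Real.exp (-(a / 5 * y)) := by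
    refine (pow_le_pow_left₀ hθ0 hθa _).trans ?_
    rw [← Real.exp_nat_mul, Real.exp_le_exp]
    push_cast
    have := mul_le_mul_of_nonneg_left hyle ha.le
    linarith
  calc (L : ℝ) ^ D * θ ^ 2 ^ m ≤ Real.exp (a / 10 * y) * Real.exp (-(a / 5 * y)) :=
        mul_le_mul hLD hθm (by positivity) (Real.exp_pos _).le
    _ = Real.exp (-(a / 10 * y)) := by
        rw [← Real.exp_add]
        congr 1
        ring

end TopCode

theorem mainTheorem8 (D : ℕ) (hD : 0 < D) (γ : ℝ) (hγ : 0 < γ) :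
    ∃ η : ℝ, 0 < η ∧
      ∀ ε : ℝ, 0 ≤ ε → ε < ((3 * 10 : ℝ) ^ (2 * D))⁻¹ →
        ∃ c : ℝ, 0 < c ∧ ∃ L₀ : ℕ,
          ∀ (L : ℕ), 0 < L → L₀ ≤ L →
          ∀ (Qubit Gen : Type) [Fintype Qubit] [Fintype Gen]
            (C : TopCode.Code D L Qubit Gen) (k : TopCode.Enclosure) (ℓ : ℕ),
            2 * ℓ ≤ L → (L : ℝ) ^ γ ≤ (ℓ : ℝ) →
            C.TQO1 ℓ → C.TQO2 k ℓ →
            ∀ T : Finset Gen → TopCode.Pauli Qubit, C.IsTestNeutral k ℓ T →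
            ∀ μ : PMF (TopCode.Pauli Qubit), C.HasSiteErrorRate μ ε →
              μ.toOuterMeasure {P | ¬ C.Corrects T ℓ P} ≤
                ENNReal.ofReal (Real.exp (-(c * (L : ℝ) ^ η))) := by
  -- The exponent `1 / 4` comes from `16 = 2 ^ 4`: a chunk of diameter up to `16 ^ m` has `2 ^ m`
  -- sites.
  refine ⟨γ / 4, by positivity, fun ε hε0 hε => ?_⟩
  have hpow : (3 * 10 : ℝ) ^ (2 * D) = 900 ^ D := by rw [pow_mul]; norm_num
  rw [hpow] at hε
  have h900 : (1 : ℝ) ≤ 900 ^ D := one_le_pow₀ (by norm_num)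
  have hε1 : ε ≤ 1 := hε.le.trans (inv_le_one_of_one_le₀ h900)
  have hθ : 900 ^ D * ε < 1 := by
    rwa [← one_div, lt_div_iff₀ (by positivity), mul_comm] at hε
  obtain ⟨c, hc, L₀, hL₀⟩ := TopCode.exists_level_bound D hγ (by positivity) hθ
  refine ⟨c, hc, L₀, fun L hL hLL Qubit Gen _ _ C k ℓ _ hℓ h1 h2 T hT μ hμ => ?_⟩
  have : NeZero L := ⟨hL.ne'⟩
  obtain ⟨m, hm, hbound⟩ := hL₀ L hL hLL ℓ hℓ
  exact (TopCode.Code.measure_not_corrects_le hm h1 h2 hT hμ hε0 hε1).trans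
    (ENNReal.ofReal_le_ofReal hbound)
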